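/- Let $C[0,1]$ be the Banach space of real-valued continuous functions on $[0,1]$ with the supremum norm $\|\cdot\|_\infty$. There exists an equivalent norm $\|\cdot\|$ on $C[0,1]$ with the following property: for every $x\in C[0,1]$ with $\|x\|=1$, every sequence $(T_n)$ of compact linear operators on $C[0,1]$ with $\lim_n\|T_nx-x\|_\infty=0$, and every $\lambda>0$, the condition $$\lim_n\lim_{\varepsilon\to0^+}\sup\bigl\{\|(1+\lambda)T_ny-\lambda y\| : y\in C[0,1],\ \|y\|\le 1,\ \|T_n(x-y)\|_\infty\le\varepsilon\bigr\}=1$$ does not hold; that is, the limit over $n$ either does not exist or is different from $1$. -/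

import Mathlib

open Filter Topology

noncomputable section

/-- `N` is an equivalent norm on the normed space `E`: a seminorm bounded above and below by
positive multiples of the given norm (the lower bound makes it a norm). -/
def IsEquivalentNorm {E : Type*} [NormedAddCommGroup E] [NormedSpace ℝ E]
    (N : Seminorm ℝ E) : Prop :=
  ∃ a : ℝ, 0 < a ∧ ∃ b : ℝ, 0 < b ∧ ∀ u : E, a * ‖u‖ ≤ N u ∧ N u ≤ b * ‖u‖

/-- `sup { N ((1 + lam) T y - lam y) : N y ≤ 1, ‖T (x - y)‖ ≤ ε }`. For an equivalent norm `N`,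
`N x ≤ 1` and `ε ≥ 0` the set is non-empty (take `y = x`) and bounded above (`T` is bounded), so
this is a genuine supremum. -/
def localSup {E : Type*} [NormedAddCommGroup E] [NormedSpace ℝ E]
    (N : Seminorm ℝ E) (T : E →L[ℝ] E) (x : E) (lam ε : ℝ) : ℝ :=
  sSup {r : ℝ | ∃ y : E, N y ≤ 1 ∧ ‖T (x - y)‖ ≤ ε ∧ r = N ((1 + lam) • T y - lam • y)}

/-- The iterated limit
`lim_n lim_{ε → 0+} sup { N ((1 + lam) T_n y - lam y) : N y ≤ 1, ‖T_n (x - y)‖ ≤ ε } = 1`. -/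
def LocalApproxCondition {E : Type*} [NormedAddCommGroup E] [NormedSpace ℝ E]
    (N : Seminorm ℝ E) (T : ℕ → E →L[ℝ] E) (x : E) (lam : ℝ) : Prop :=
  ∃ L : ℕ → ℝ,
    (∀ n, Tendsto (fun ε : ℝ => localSup N (T n) x lam ε) (𝓝[>] 0) (𝓝 (L n))) ∧
    Tendsto L atTop (𝓝 1)

end

/-!
The supremum norm itself works, because `C[0,1]` has the diametral diameter two property: every
weak neighbourhood of a unit vector `x` contains a point `y` of the unit ball with `‖x - y‖`
almost `2`. Such a `y` is obtained by reflecting `x` on one of infinitely many disjoint bumps placed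
where `|x|` is almost `1`; disjointness makes the bumps tend weakly to zero. As a compact operator
`T` is weak-to-norm continuous on bounded sets, `y` may be chosen with `T y ≈ T x`. If moreover
`T x ≈ x`, then `(1 + lam) T y - lam y ≈ (1 + lam) (x - y) + y` has norm at least about
`2 (1 + lam) - 1 = 1 + 2 lam > 1`.
-/

open Function Set

section WeakEstimates

variable {𝕜 E F ι : Type*} [RCLike 𝕜] [SeminormedAddCommGroup E] [NormedSpace 𝕜 E]
  [NormedAddCommGroup F] [NormedSpace 𝕜 F]

variable (𝕜) in
theorem exists_finset_dual_norm_lt_of_isCompact {C : Set E} (hC : IsCompact C) {δ ε : ℝ}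
    (hδε : δ < ε) :
    ∃ s : Finset (StrongDual 𝕜 E), ∀ z ∈ C, (∀ f ∈ s, ‖f z‖ ≤ δ) → ‖z‖ < ε := by
  have hC' : IsCompact (C ∩ {z | ε ≤ ‖z‖}) :=
    hC.inter_right (isClosed_le continuous_const continuous_norm)
  obtain ⟨s, hs⟩ := hC'.elim_finite_subcover (fun f : StrongDual 𝕜 E => {z | δ < ‖f z‖})
    (fun f => isOpen_lt continuous_const f.continuous.norm) fun z hz => by
      obtain ⟨f, -, hf⟩ := exists_dual_vector'' 𝕜 z
      exact mem_iUnion.2 ⟨f, by simpa [hf] using hδε.trans_le hz.2⟩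
  refine ⟨s, fun z hzC hz => lt_of_not_ge fun hεz => ?_⟩
  obtain ⟨f, hf, hfz⟩ := mem_iUnion₂.1 (hs ⟨hzC, hεz⟩)
  exact (hz f hf).not_gt hfz

theorem exists_finset_dual_norm_map_lt_of_isCompactOperator {T : E →L[𝕜] F}
    (hT : IsCompactOperator T) (r : ℝ) {δ ε : ℝ} (hδε : δ < ε) :
    ∃ s : Finset (StrongDual 𝕜 E), ∀ z, ‖z‖ ≤ r → (∀ f ∈ s, ‖f z‖ ≤ δ) → ‖T z‖ < ε := by
  classical
  have hC : IsCompact (closure (T '' Metric.closedBall 0 r)) :=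
    IsCompactOperator.isCompact_closure_image_closedBall (f := T.toLinearMap) hT r
  obtain ⟨s, hs⟩ := exists_finset_dual_norm_lt_of_isCompact 𝕜 hC hδε
  refine ⟨s.image fun f => f.comp T, fun z hz hsz => hs (T z) ?_ ?_⟩
  · exact subset_closure (mem_image_of_mem T (mem_closedBall_zero_iff.2 hz))
  · exact fun f hf => hsz _ (Finset.mem_image_of_mem _ hf)

theorem summable_norm_dual_apply_of_norm_sum_smul_le {u : ι → E} {C : ℝ}
    (hu : ∀ (σ : ι → 𝕜) (s : Finset ι), (∀ i, ‖σ i‖ = 1) → ‖∑ i ∈ s, σ i • u i‖ ≤ C)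
    (f : StrongDual 𝕜 E) : Summable fun i => ‖f (u i)‖ := by
  choose σ hσ hσu using fun i => RCLike.exists_norm_eq_mul_self (f (u i))
  refine summable_of_sum_le (c := ‖f‖ * C) (fun i => norm_nonneg _) fun s => ?_
  have hsum : ((∑ i ∈ s, ‖f (u i)‖ : ℝ) : 𝕜) = f (∑ i ∈ s, σ i • u i) := by
    simp only [map_sum, map_smul, smul_eq_mul, ← hσu]
  calc ∑ i ∈ s, ‖f (u i)‖ = ‖f (∑ i ∈ s, σ i • u i)‖ := by
        rw [← hsum, RCLike.norm_of_nonneg (by positivity)]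
    _ ≤ ‖f‖ * ‖∑ i ∈ s, σ i • u i‖ := f.le_opNorm _
    _ ≤ ‖f‖ * C := by gcongr; exact hu σ s hσ

end WeakEstimates

section DisjointSupports

variable {K F ι : Type*} [TopologicalSpace K]

theorem norm_sum_le_of_pairwise_disjoint_support [CompactSpace K] [SeminormedAddCommGroup F]
    {u : ι → C(K, F)} (hu : Pairwise (Disjoint on fun i => support (u i))) {C : ℝ} (hC : 0 ≤ C)
    (huC : ∀ i, ‖u i‖ ≤ C) (s : Finset ι) : ‖∑ i ∈ s, u i‖ ≤ C := by
  refine (ContinuousMap.norm_le _ hC).2 fun t => ?_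
  rw [ContinuousMap.sum_apply]
  by_cases ht : ∃ i ∈ s, u i t ≠ 0
  · obtain ⟨i, hi, hit⟩ := ht
    rw [Finset.sum_eq_single_of_mem i hi fun j _ hji =>
      notMem_support.1 (disjoint_right.1 (hu hji) hit)]
    exact ((u i).norm_coe_le_norm t).trans (huC i)
  · push Not at ht
    rwa [Finset.sum_eq_zero ht, norm_zero]

theorem tendsto_dual_apply_of_pairwise_disjoint_support {𝕜 : Type*} [RCLike 𝕜] [CompactSpace K]
    [SeminormedAddCommGroup F] [NormedSpace 𝕜 F] {u : ι → C(K, F)}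
    (hu : Pairwise (Disjoint on fun i => support (u i))) {C : ℝ} (huC : ∀ i, ‖u i‖ ≤ C)
    (f : StrongDual 𝕜 C(K, F)) : Tendsto (fun i => f (u i)) cofinite (𝓝 0) := by
  refine tendsto_zero_iff_norm_tendsto_zero.2 (Summable.tendsto_cofinite_zero ?_)
  refine summable_norm_dual_apply_of_norm_sum_smul_le (C := max C 0) (fun σ s hσ => ?_) f
  refine norm_sum_le_of_pairwise_disjoint_support (u := fun i => σ i • u i)
    (fun i j hij => (hu hij).mono ?_ ?_) (le_max_right C 0) (fun i => ?_) s
  · exact support_const_smul_subset (σ i) (u i)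
  · exact support_const_smul_subset (σ j) (u j)
  · rw [norm_smul, hσ, one_mul]
    exact (huC i).trans (le_max_left C 0)

theorem exists_seq_isOpen_subset_pairwise_disjoint [T2Space K] {U : Set K} (hU : IsOpen U)
    (hUinf : U.Infinite) :
    ∃ V : ℕ → Set K, (∀ n, IsOpen (V n)) ∧ (∀ n, (V n).Nonempty) ∧ (∀ n, V n ⊆ U) ∧
      Pairwise (Disjoint on V) := by
  have := hUinf.to_subtype
  obtain ⟨V, hVinf, hVo, hV⟩ := exists_seq_infinite_isOpen_pairwise_disjoint U
  exact ⟨fun n => (↑) '' V n, fun n => hU.isOpenMap_subtype_val _ (hVo n),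
    fun n => (hVinf n).nonempty.image _, fun n => Subtype.coe_image_subset U (V n),
    fun i j hij => (disjoint_image_iff Subtype.val_injective).2 (hV hij)⟩

theorem exists_bump_of_isOpen [CompletelyRegularSpace K] {U : Set K} (hU : IsOpen U) {p : K}
    (hp : p ∈ U) :
    ∃ g : C(K, ℝ), g p = 1 ∧ (∀ t, g t ∈ Icc 0 1) ∧ support g ⊆ U := by
  obtain ⟨f, hf, hfp, hfU⟩ := completelyRegularSpace_iff_isOpen.1 ‹_› p U hU hp
  refine ⟨⟨fun t => 1 - f t, by fun_prop⟩, by simp [hfp], fun t => ?_, fun t ht => ?_⟩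
  · exact ⟨unitInterval.one_minus_nonneg (f t), unitInterval.one_minus_le_one (f t)⟩
  · by_contra htU
    exact ht (by simp [hfU htU])

theorem exists_seq_bump_pairwise_disjoint_support [T35Space K] {U : Set K}
    (hU : IsOpen U) (hUinf : U.Infinite) :
    ∃ (g : ℕ → C(K, ℝ)) (p : ℕ → K), (∀ n, p n ∈ U) ∧ (∀ n, g n (p n) = 1) ∧
      (∀ n t, g n t ∈ Icc 0 1) ∧ Pairwise (Disjoint on fun n => support (g n)) := by
  obtain ⟨V, hVo, hVne, hVU, hV⟩ := exists_seq_isOpen_subset_pairwise_disjoint hU hUinf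
  choose p hp using hVne
  choose g hgp hg hgV using fun n => exists_bump_of_isOpen (hVo n) (hp n)
  exact ⟨g, p, fun n => hVU n (hp n), hgp, hg, fun i j hij => (hV hij).mono (hgV i) (hgV j)⟩

end DisjointSupports

/-- The diametral diameter two property of a real normed space: every weak neighbourhood of a unit
vector `x` contains points of the unit ball at distance almost `2` from `x`. A basic weak
neighbourhood is given by a finite set `s` of functionals and a bound `ε`; using the same `ε` for
the distance loses nothing, since both conditions become stronger as `ε` decreases. -/
def DiametralDiameterTwo (E : Type*) [NormedAddCommGroup E] [NormedSpace ℝ E] : Prop :=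
  ∀ x : E, ‖x‖ = 1 → ∀ (s : Finset (StrongDual ℝ E)) (ε : ℝ), 0 < ε →
    ∃ y : E, ‖y‖ ≤ 1 ∧ (∀ f ∈ s, ‖f (x - y)‖ ≤ ε) ∧ 2 - ε ≤ ‖x - y‖

section ContinuousFunctions

variable {K F : Type*} [TopologicalSpace K] [CompactSpace K] [NormedAddCommGroup F]
  [NormedSpace ℝ F]

theorem norm_smul_le_of_abs_le_one {g : C(K, ℝ)} (hg : ∀ t, |g t| ≤ 1) (x : C(K, F)) :
    ‖g • x‖ ≤ ‖x‖ := by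
  refine (ContinuousMap.norm_le _ (norm_nonneg x)).2 fun t => ?_
  rw [ContinuousMap.smul_apply', norm_smul]
  exact (mul_le_of_le_one_left (norm_nonneg _) (hg t)).trans (x.norm_coe_le_norm t)

theorem norm_sub_two_smul_smul_le {g : C(K, ℝ)} (hg : ∀ t, g t ∈ Icc 0 1) (x : C(K, F)) :
    ‖x - (2 : ℝ) • g • x‖ ≤ ‖x‖ := by
  have hreflect : x - (2 : ℝ) • g • x = (1 - (2 : ℝ) • g) • x := by
    ext t
    simp [sub_smul, mul_smul]
  rw [hreflect]
  refine norm_smul_le_of_abs_le_one (fun t => abs_le.2 ?_) x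
  obtain ⟨hg₀, hg₁⟩ := hg t
  simp only [ContinuousMap.sub_apply, ContinuousMap.one_apply, ContinuousMap.smul_apply,
    smul_eq_mul]
  constructor <;> linarith

theorem tendsto_dual_smul_of_pairwise_disjoint_support {ι : Type*} {g : ι → C(K, ℝ)}
    (hg : Pairwise (Disjoint on fun i => support (g i))) (hg₁ : ∀ i t, |g i t| ≤ 1) (x : C(K, F))
    (f : StrongDual ℝ C(K, F)) : Tendsto (fun i => f (g i • x)) cofinite (𝓝 0) :=
  tendsto_dual_apply_of_pairwise_disjoint_support (fun i j hij => (hg hij).mono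
    (support_smul_subset_left (g i) x) (support_smul_subset_left (g j) x))
    (fun i => norm_smul_le_of_abs_le_one (hg₁ i) x) f

theorem diametralDiameterTwo_continuousMap [T2Space K] [PerfectSpace K] :
    DiametralDiameterTwo C(K, F) := by
  intro x hx s ε hε
  obtain ⟨q, hq⟩ : ∃ q, 1 ≤ ‖x q‖ := by
    by_contra! hlt
    exact ((x.norm_lt_iff one_pos).2 hlt).ne hx
  have hU : IsOpen {t | 1 - ε / 2 < ‖x t‖} := isOpen_lt continuous_const x.continuous.norm
  have hqU : 1 - ε / 2 < ‖x q‖ := by linarith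
  obtain ⟨g, p, hpU, hgp, hg, hdisj⟩ :=
    exists_seq_bump_pairwise_disjoint_support hU (infinite_of_mem_nhds q (hU.mem_nhds hqU))
  have hg₁ : ∀ n t, |g n t| ≤ 1 := fun n t => abs_le.2 ⟨by linarith [(hg n t).1], (hg n t).2⟩
  have hweak : ∀ f ∈ s, ∀ᶠ n in cofinite, ‖f (g n • x)‖ < ε / 2 := fun f _ =>
    (tendsto_zero_iff_norm_tendsto_zero.1
      (tendsto_dual_smul_of_pairwise_disjoint_support hdisj hg₁ x f)).eventually_lt_const
      (half_pos hε)
  obtain ⟨n, hn⟩ := ((Finset.eventually_all s).2 hweak).exists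
  refine ⟨x - (2 : ℝ) • g n • x, hx ▸ norm_sub_two_smul_smul_le (hg n) x, fun f hf => ?_, ?_⟩
  · rw [sub_sub_cancel, map_smul, norm_smul, Real.norm_two]
    linarith [hn f hf]
  · rw [sub_sub_cancel]
    calc 2 - ε ≤ 2 * ‖x (p n)‖ := by linarith [show 1 - ε / 2 < ‖x (p n)‖ from hpU n]
      _ = ‖((2 : ℝ) • g n • x) (p n)‖ := by simp [norm_smul, hgp]
      _ ≤ ‖(2 : ℝ) • g n • x‖ := ContinuousMap.norm_coe_le_norm _ _

end ContinuousFunctions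

section LocalSup

variable {E : Type*} [NormedAddCommGroup E] [NormedSpace ℝ E]

theorem isEquivalentNorm_normSeminorm : IsEquivalentNorm (normSeminorm ℝ E) :=
  ⟨1, one_pos, 1, one_pos, fun u => by simp⟩

theorem IsEquivalentNorm.le_localSup {N : Seminorm ℝ E} (hN : IsEquivalentNorm N)
    {T : E →L[ℝ] E} {x y : E} {lam ε : ℝ} (hy : N y ≤ 1) (hTy : ‖T (x - y)‖ ≤ ε) :
    N ((1 + lam) • T y - lam • y) ≤ localSup N T x lam ε := by
  obtain ⟨a, ha, b, hb, hab⟩ := hN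
  let S : E →L[ℝ] E := (1 + lam) • T - lam • ContinuousLinearMap.id ℝ E
  refine le_csSup ⟨b * (‖S‖ * (1 / a)), ?_⟩ ⟨y, hy, hTy, rfl⟩
  rintro _ ⟨z, hz, -, rfl⟩
  have hza : ‖z‖ ≤ 1 / a := (le_div_iff₀' ha).2 ((hab z).1.trans hz)
  calc N (S z) ≤ b * ‖S z‖ := (hab _).2
    _ ≤ b * (‖S‖ * (1 / a)) := by gcongr; exact S.le_opNorm_of_le hza

theorem le_norm_smul_map_sub_smul (T : E →L[ℝ] E) (x y : E) {lam : ℝ} (hlam : 0 ≤ 1 + lam) :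
    (1 + lam) * (‖x - y‖ - ‖T (x - y)‖ - ‖T x - x‖) - ‖y‖ ≤ ‖(1 + lam) • T y - lam • y‖ := by
  have hsplit : (1 + lam) • (x - y) =
      ((1 + lam) • T y - lam • y) + (1 + lam) • T (x - y) - (1 + lam) • (T x - x) - y := by
    rw [map_sub]
    module
  have htriangle : ‖(1 + lam) • (x - y)‖ ≤ ‖(1 + lam) • T y - lam • y‖ +
      ‖(1 + lam) • T (x - y)‖ + ‖(1 + lam) • (T x - x)‖ + ‖y‖ := by
    rw [hsplit]
    exact norm_sub_le_of_le (norm_sub_le_of_le (norm_add_le _ _) le_rfl) le_rfl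
  simp only [norm_smul, Real.norm_of_nonneg hlam] at htriangle
  linarith

namespace DiametralDiameterTwo

theorem exists_norm_map_sub_le (hE : DiametralDiameterTwo E) {F : Type*} [NormedAddCommGroup F]
    [NormedSpace ℝ F] {T : E →L[ℝ] F} (hT : IsCompactOperator T) {x : E} (hx : ‖x‖ = 1) {ε : ℝ}
    (hε : 0 < ε) : ∃ y : E, ‖y‖ ≤ 1 ∧ ‖T (x - y)‖ ≤ ε ∧ 2 - ε ≤ ‖x - y‖ := by
  obtain ⟨s, hs⟩ := exists_finset_dual_norm_map_lt_of_isCompactOperator hT 2 (half_lt_self hε)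
  obtain ⟨y, hy, hsy, hxy⟩ := hE x hx s (ε / 2) (half_pos hε)
  have hxy₂ : ‖x - y‖ ≤ 2 := by linarith [norm_sub_le x y]
  exact ⟨y, hy, (hs _ hxy₂ hsy).le, by linarith⟩

theorem le_localSup (hE : DiametralDiameterTwo E) {T : E →L[ℝ] E} (hT : IsCompactOperator T)
    {x : E} (hx : ‖x‖ = 1) {lam ε : ℝ} (hlam : 0 ≤ 1 + lam) (hε : 0 < ε) :
    (1 + lam) * (2 - 2 * ε - ‖T x - x‖) - 1 ≤ localSup (normSeminorm ℝ E) T x lam ε := by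
  obtain ⟨y, hy, hTy, hxy⟩ := hE.exists_norm_map_sub_le hT hx hε
  calc (1 + lam) * (2 - 2 * ε - ‖T x - x‖) - 1
      ≤ (1 + lam) * (‖x - y‖ - ‖T (x - y)‖ - ‖T x - x‖) - ‖y‖ := by
        gcongr (1 + lam) * ?_ - ?_
        linarith
    _ ≤ ‖(1 + lam) • T y - lam • y‖ := le_norm_smul_map_sub_smul T x y hlam
    _ ≤ localSup (normSeminorm ℝ E) T x lam ε := isEquivalentNorm_normSeminorm.le_localSup hy hTy

theorem not_localApproxCondition (hE : DiametralDiameterTwo E) {x : E} (hx : ‖x‖ = 1)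
    {T : ℕ → E →L[ℝ] E} (hT : ∀ n, IsCompactOperator (T n))
    (hTx : Tendsto (fun n => ‖T n x - x‖) atTop (𝓝 0)) {lam : ℝ} (hlam : 0 < lam) :
    ¬ LocalApproxCondition (normSeminorm ℝ E) T x lam := by
  rintro ⟨L, hL, hL₁⟩
  have hle : ∀ n, (1 + lam) * (2 - ‖T n x - x‖) - 1 ≤ L n := fun n => by
    have hlim : Tendsto (fun ε : ℝ => (1 + lam) * (2 - 2 * ε - ‖T n x - x‖) - 1) (𝓝[>] 0)
        (𝓝 ((1 + lam) * (2 - 2 * 0 - ‖T n x - x‖) - 1)) :=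
      (Continuous.tendsto (by fun_prop) 0).mono_left nhdsWithin_le_nhds
    rw [mul_zero, sub_zero] at hlim
    refine le_of_tendsto_of_tendsto hlim (hL n) ?_
    filter_upwards [self_mem_nhdsWithin] with ε hε
    exact hE.le_localSup (hT n) hx (by linarith) hε
  have := le_of_tendsto_of_tendsto' (((hTx.const_sub 2).const_mul (1 + lam)).sub_const 1) hL₁ hle
  linarith

end DiametralDiameterTwo

end LocalSup

theorem mainTheorem11_general {K F : Type*} [TopologicalSpace K] [CompactSpace K] [T2Space K]
    [PerfectSpace K] [NormedAddCommGroup F] [NormedSpace ℝ F] {x : C(K, F)} (hx : ‖x‖ = 1)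
    {T : ℕ → C(K, F) →L[ℝ] C(K, F)} (hT : ∀ n, IsCompactOperator (T n))
    (hTx : Tendsto (fun n => ‖T n x - x‖) atTop (𝓝 0)) {lam : ℝ} (hlam : 0 < lam) :
    ¬ LocalApproxCondition (normSeminorm ℝ C(K, F)) T x lam :=
  diametralDiameterTwo_continuousMap.not_localApproxCondition hx hT hTx hlam

theorem mainTheorem11 :
    ∃ N : Seminorm ℝ C(unitInterval, ℝ), IsEquivalentNorm N ∧
      ∀ x : C(unitInterval, ℝ), N x = 1 →
        ∀ T : ℕ → (C(unitInterval, ℝ) →L[ℝ] C(unitInterval, ℝ)),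
          (∀ n, IsCompactOperator (T n)) →
          Tendsto (fun n => ‖T n x - x‖) atTop (𝓝 0) →
          ∀ lam : ℝ, 0 < lam → ¬ LocalApproxCondition N T x lam :=
  ⟨normSeminorm ℝ _, isEquivalentNorm_normSeminorm,
    fun _ hx _ hT hTx _ hlam => mainTheorem11_general hx hT hTx hlam⟩
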